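/- Model. A routing protocol on the path with positions $0,\dots,n-1$ is built from reversals of contiguous segments. A reversal of a segment of $\ell$ positions takes time $(\ell+1)/3$; the times of successive stages add up, and stages that act on disjoint segments are carried out in parallel, so that they take the maximum of their times. Tripartite Binary Sort (TBS). For a binary string $B$ of length at most $1$ nothing is done. A binary string $B$ of length $m\ge 2$ is cut into three contiguous segments $B_1,B_2,B_3$, consisting of the positions in $[0,c_1(m))$, $[c_1(m),c_2(m))$, $[c_2(m),m)$. In parallel, $B_1$ and $B_3$ are sorted recursively by TBS, and $B_2$ is sorted backwards, by TBS applied to its bitwise complement. Then, with $i$ the position of the first $1$ and $j$ the position of the last $0$ in the resulting string, the segment from $i$ to $j$ (inclusive) is reversed; if the string is already sorted, this step is omitted. Here $c=(c_1,c_2)$ is any fixed rule for rounding the thirds: integers $0\le c_1(m)\le c_2(m)\le m$ with $|c_1(m)-m/3|\le 1$, $|c_2(m)-2m/3|\le 1$ and $c_2(m)-c_1(m)<m$ for all $m\ge2$ (for example $c_1(m)=\lfloor m/3\rfloor$, $c_2(m)=\lfloor 2m/3\rfloor$, or $c_1(m)=\lfloor m/3\rfloor+1$, $c_2(m)=\lfloor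 2m/3\rfloor+1$). GDC(TBS). For a permutation $\pi$ of length $n$, given as the sequence $\pi_0,\dots,\pi_{n-1}$ of destinations, nothing is done if $n\le1$. Otherwise, the $\lfloor n/2\rfloor$ smallest destinations are labelled $0$ and the other $\lceil n/2\rceil$ are labelled $1$, the reversals by which TBS sorts this binary string are carried out on $\pi$, and then the same procedure is applied recursively, in parallel, to the left part (the first $\lfloor n/2\rfloor$ positions) and to the right part (the other positions). The routing time of GDC(TBS) on $\pi$ is the running time of the resulting protocol. Theorem. Let $\overline T_c(n)$ be the expected routing time of GDC(TBS), with rounding rule $c$, on a uniformly random permutation of length $n$. There is a constant $\alpha\in(\tfrac12,1)$ such that for every rounding rule $c$ $$\overline T_c(n)=\frac{2n}{3}+O(n^{\alpha})\qquad(n\to\infty),$$ that is, $|\overline T_c(n)-2n/3|\le C\,n^{\alpha}$ for all sufficiently large $n$, where the constant $C$ does not depend on $n$. -/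

import Mathlib

open Filter Asymptotics
open scoped Nat

namespace PathRouting

/-- A routing protocol on a path, built from segment reversals.  Positions are numbered from `0`.
* `idle`: do nothing;
* `rev i l`: reverse the segment of length `l` starting at position `i`
  (the reversal `ρ(i, i + l - 1)`, endpoints inclusive);
* `seq p q`: first `p`, then `q`;
* `par p q`: `p` and `q` executed simultaneously; it is used below only for
  protocols that act on disjoint segments of the path. -/
inductive Protocol : Type
  | idle : Protocol
  | rev (i l : ℕ) : Protocol
  | seq (p q : Protocol) : Protocol
  | par (p q : Protocol) : Protocol

/-- Reversal of the segment of length `l` that starts at position `i`. -/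
def reverseSegment {α : Type*} (i l : ℕ) (S : List α) : List α :=
  S.take i ++ ((S.drop i).take l).reverse ++ (S.drop i).drop l

namespace Protocol

/-- The result `S · ρ̄` of carrying out a protocol on a sequence `S`. -/
def apply {α : Type*} : Protocol → List α → List α
  | idle, S => S
  | rev i l, S => reverseSegment i l S
  | seq p q, S => q.apply (p.apply S)
  | par p q, S => q.apply (p.apply S)

/-- The same protocol, carried out `k` positions further to the right. -/
def shift (k : ℕ) : Protocol → Protocol
  | idle => idle
  | rev i l => rev (k + i) l
  | seq p q => seq (p.shift k) (q.shift k)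
  | par p q => par (p.shift k) (q.shift k)

/-- The running time of a protocol: a reversal of length `l` takes time `(l + 1) / 3`,
successive stages add up, and simultaneous ones take the maximum. -/
noncomputable def time : Protocol → ℝ
  | idle => 0
  | rev _ l => ((l : ℝ) + 1) / 3
  | seq p q => p.time + q.time
  | par p q => max p.time q.time

theorem length_apply {α : Type*} (p : Protocol) (S : List α) :
    (p.apply S).length = S.length := by
  induction p generalizing S with
  | idle => rfl
  | rev i l =>
    simp only [apply, reverseSegment, List.length_append, List.length_take, List.length_reverse,
      List.length_drop]
    omega
  | seq p q hp hq => simp only [apply, hq, hp]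
  | par p q hp hq => simp only [apply, hq, hp]

end Protocol

/-- The merging step on a binary string `B` (`true` is the bit `1`): with `i` the index of the
first `1` and `j` the index of the last `0`, the reversal `ρ(i, j)`.  Nothing is done
when `B` is already sorted.  (If `B` has no `1` then `i = |B|`, and if `B` has no `0`
then `i = j = 0`, so that nothing is done in these cases either.) -/
def mergeStep (B : List Bool) : Protocol :=
  let i := B.findIdx (fun b => b)
  let j := B.length - 1 - B.reverse.findIdx (fun b => !b)
  if i < j then Protocol.rev i (j + 1 - i) else Protocol.idle

/-- A rule for cutting strings into nearly equal thirds: a string of length `n ≥ 2` is cut into the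
segments `[0, fst n)`, `[fst n, snd n)`, `[snd n, n)`, where the cut points are within distance `1`
of `n / 3` and `2 n / 3`.  The last field only concerns `n = 2` and `n = 3`, where it says
that the middle segment is not the whole string. -/
structure ThirdsRule where
  fst : ℕ → ℕ
  snd : ℕ → ℕ
  fst_le_snd : ∀ n, 2 ≤ n → fst n ≤ snd n
  snd_le : ∀ n, 2 ≤ n → snd n ≤ n
  fst_near : ∀ n, 2 ≤ n → n ≤ 3 * fst n + 3 ∧ 3 * fst n ≤ n + 3
  snd_near : ∀ n, 2 ≤ n → 2 * n ≤ 3 * snd n + 3 ∧ 3 * snd n ≤ 2 * n + 3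
  mid_lt : ∀ n, 2 ≤ n → snd n - fst n < n

/-- The rule with `m₁ = ⌊n / 3⌋` and `m₂ = ⌊2 n / 3⌋` as the lengths of the first
segment and of the first two segments. -/
def ThirdsRule.byLength : ThirdsRule where
  fst n := n / 3
  snd n := 2 * n / 3
  fst_le_snd := by intros; omega
  snd_le := by intros; omega
  fst_near := by intros; omega
  snd_near := by intros; omega
  mid_lt := by intros; omega

/-- The rule with `m₁ = ⌊n / 3⌋` and `m₂ = ⌊2 n / 3⌋` as the last positions (counted from `0`) of
the first and of the second segment. -/
def ThirdsRule.byLastPosition : ThirdsRule where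
  fst n := n / 3 + 1
  snd n := 2 * n / 3 + 1
  fst_le_snd := by intros; omega
  snd_le := by intros; omega
  fst_near := by intros; omega
  snd_near := by intros; omega
  mid_lt := by intros; omega

/-- Tripartite Binary Sort: cut `B` into contiguous thirds, sort the outer thirds forwards and the
middle third backwards (by sorting its bitwise complement), the three in parallel, and merge. -/
def tbs (c : ThirdsRule) (B : List Bool) : Protocol :=
  if _h : B.length ≤ 1 then Protocol.idle
  else
    let m₁ := c.fst B.length
    let m₂ := c.snd B.length
    let p₀ := tbs c (B.take m₁)
    let p₁ := (tbs c (((B.take m₂).drop m₁).map (fun b => !b))).shift m₁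
    let p₂ := (tbs c (B.drop m₂)).shift m₂
    let p := Protocol.par p₀ (Protocol.par p₁ p₂)
    Protocol.seq p (mergeStep (p.apply B))
termination_by B.length
decreasing_by
  all_goals
    have hB : 2 ≤ B.length := by omega
    have h₁ := c.fst_near _ hB
    have h₂ := c.snd_near _ hB
    have h₃ := c.mid_lt _ hB
    have h₄ := c.snd_le _ hB
    simp only [List.length_map, List.length_drop, List.length_take]
    omega

/-- The binary labeling of a sequence `π` listing the labels `lo, …, lo + |π| - 1` in some order:
the `⌊|π| / 2⌋` smallest labels get the bit `0`, the other `⌈|π| / 2⌉` labels the bit `1`. -/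
def binaryLabeling (lo : ℕ) (π : List ℕ) : List Bool :=
  π.map (fun v => decide (lo + π.length / 2 ≤ v))

/-- Generic divide and conquer, for the sequence `π` of the destinations `lo, …, lo + |π| - 1`:
sort the binary labeling of `π` with `sorter`, carry this out on `π`, and continue with the left
and the right half in parallel.  Positions are relative to the segment on which `π` stands. -/
def gdc (sorter : List Bool → Protocol) (lo : ℕ) (π : List ℕ) : Protocol :=
  if _h : π.length ≤ 1 then Protocol.idle
  else
    let k := π.length / 2
    let p := sorter (binaryLabeling lo π)
    Protocol.seq p
      (Protocol.par (gdc sorter lo ((p.apply π).take k))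
        ((gdc sorter (lo + k) ((p.apply π).drop k)).shift k))
termination_by π.length
decreasing_by
  all_goals
    simp only [List.length_drop, List.length_take, Protocol.length_apply]
    omega

/-- The protocol that GDC(TBS) finds for `π`, where `π i` is the destination of the token that
starts at position `i`. -/
def gdcTBS (c : ThirdsRule) {n : ℕ} (π : Equiv.Perm (Fin n)) : Protocol :=
  gdc (tbs c) 0 (List.ofFn (fun i => (π i : ℕ)))

/-- The expected routing time of GDC(TBS) on a uniformly random permutation of length `n`. -/
noncomputable def averageTime (c : ThirdsRule) (n : ℕ) : ℝ :=
  (∑ π : Equiv.Perm (Fin n), (gdcTBS c π).time) / (n ! : ℝ)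

end PathRouting

/-!
A mean-square argument which uses no independence shows that `α = 3 / 4` works for every rounding
rule.

*Tripartite Binary Sort.* It sorts (`tbs_fits_apply`), so before the merging step of a string `B` of
length `m` the string has the form `0ᵃ1ᵇ⁺ˣ0ʸ⁺ᵉ1ᶠ`, where `b` counts the `1`s of the left third,
`x + y` is the length of the middle third and `e` counts the `0`s of the right third.  The merging
step reverses the two middle blocks.  This takes time `2 m / 9`, up to a multiple of the imbalances
`|b - m / 6|`, `|e - m / 6|` and a constant (`abs_mergeStep_time_sub_le`); this includes the case
where nothing is reversed, since an outer third is constant then and has imbalance about `m / 6`.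
The value `m / 3` solves
`t(m) = t(m / 3) + 2 m / 9`.  As the maximum is `1`-Lipschitz, the squared deviation of the maximum
of three times is at most the sum of the three squared deviations.  Hence the mean squared deviation
`v` satisfies `v(m) ≤ (1 + ε) * 3 * v(m / 3) + O(m)`
as soon as the imbalance of every window of length `l` has mean square `O(l)`, a property that is
inherited by the recursive calls (`BalancedFamily`).  Because `3 * (1 / 3) ^ (3 / 2) < 1`, the
recursion gives `v(m) = O(m ^ (3 / 2))` (`sum_tbs_time_sub_sq_le`).

*The random labeling.* The binary labeling of a uniformly random permutation is such a balanced
family, since the labels at two distinct positions are negatively correlated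
(`sum_perm_mul_nonpos`, `balancedFamily_binaryLabeling`).

*Divide and conquer.* The first stage depends on the binary labeling only, so it is equivariant
under relabelling the small labels among themselves, and likewise the large ones.
Averaging over all such relabellings shows that the two halves are uniformly distributed
(`factorial_mul_sum_eq_of_equivariant`).  With `2 * (1 / 2) ^ (3 / 2) < 1`, the same recursion as
before bounds the mean squared deviation of the routing time from `2 n / 3` by `O(n ^ (3 / 2))`
(`sum_gdc_time_sub_sq_le`), and the Cauchy-Schwarz inequality finishes the proof.
-/

namespace PathRouting

/-! ### Protocols acting on sequences -/

theorem reverseSegment_map {α β : Type*} (f : α → β) (i l : ℕ) (S : List α) :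
    reverseSegment i l (S.map f) = (reverseSegment i l S).map f := by
  simp [reverseSegment, List.map_take, List.map_drop, List.map_reverse]

namespace Protocol

/-- Protocols move positions and do not look at entries. -/
theorem apply_map {α β : Type*} (f : α → β) (p : Protocol) (S : List α) :
    p.apply (S.map f) = (p.apply S).map f := by
  induction p generalizing S with
  | idle => rfl
  | rev i l => exact reverseSegment_map f i l S
  | seq p q hp hq => simp only [apply, hp, hq]
  | par p q hp hq => simp only [apply, hp, hq]

theorem perm_apply {α : Type*} (p : Protocol) (S : List α) : (p.apply S).Perm S := by
  induction p generalizing S with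
  | idle => exact List.Perm.refl _
  | rev i l =>
    simp only [apply, reverseSegment]
    calc _ = S.take i ++ ((((S.drop i).take l).reverse) ++ (S.drop i).drop l) := by simp
      _ |>.Perm (S.take i ++ (((S.drop i).take l) ++ (S.drop i).drop l)) :=
        ((List.reverse_perm _).append_right _).append_left _
      _ = S := by simp
  | seq p q hp hq => exact (hq _).trans (hp _)
  | par p q hp hq => exact (hq _).trans (hp _)

theorem apply_shift {α : Type*} (p : Protocol) (A S : List α) :
    (p.shift A.length).apply (A ++ S) = A ++ p.apply S := by
  induction p generalizing S with
  | idle => rfl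
  | rev i l =>
    have h₁ : A.take (A.length + i) = A := List.take_of_length_le (by omega)
    have h₂ : A.drop (A.length + i) = [] := List.drop_eq_nil_of_le (by omega)
    simp only [apply, shift, reverseSegment, List.take_append, List.drop_append, h₁, h₂,
      Nat.add_sub_cancel_left, List.append_assoc, List.nil_append]
  | seq p q hp hq => simp only [apply, shift, hp, hq]
  | par p q hp hq => simp only [apply, shift, hp, hq]

theorem time_shift (k : ℕ) (p : Protocol) : (p.shift k).time = p.time := by
  induction p with
  | idle => rfl
  | rev i l => rfl
  | seq p q hp hq => simp only [time, shift, hp, hq]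
  | par p q hp hq => simp only [time, shift, hp, hq]

theorem time_nonneg (p : Protocol) : 0 ≤ p.time := by
  induction p with
  | idle => exact le_rfl
  | rev i l => simp only [time]; positivity
  | seq p q hp hq => simp only [time]; positivity
  | par p q hp hq => exact le_max_of_le_left hp

/-- Every reversal of the protocol stays within the first `m` positions. -/
def Fits (m : ℕ) : Protocol → Prop
  | idle => True
  | rev i l => i + l ≤ m
  | seq p q => p.Fits m ∧ q.Fits m
  | par p q => p.Fits m ∧ q.Fits m

theorem Fits.mono {m n : ℕ} (h : m ≤ n) {p : Protocol} (hp : p.Fits m) : p.Fits n := by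
  induction p with
  | idle => trivial
  | rev i l => exact le_trans hp h
  | seq p q ihp ihq => exact ⟨ihp hp.1, ihq hp.2⟩
  | par p q ihp ihq => exact ⟨ihp hp.1, ihq hp.2⟩

theorem Fits.shift {m : ℕ} (k : ℕ) {p : Protocol} (hp : p.Fits m) :
    (p.shift k).Fits (k + m) := by
  induction p with
  | idle => trivial
  | rev i l => simp only [Protocol.shift, Fits] at *; omega
  | seq p q ihp ihq => exact ⟨ihp hp.1, ihq hp.2⟩
  | par p q ihp ihq => exact ⟨ihp hp.1, ihq hp.2⟩

/-- A protocol that stays within `S` does not see what follows `S`. -/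
theorem Fits.apply_append {α : Type*} {p : Protocol} {S : List α} (hp : p.Fits S.length)
    (C : List α) : p.apply (S ++ C) = p.apply S ++ C := by
  induction p generalizing S with
  | idle => rfl
  | rev i l =>
    simp only [Fits] at hp
    have h₁ : i - S.length = 0 := by omega
    have h₂ : l - (S.length - i) = 0 := by omega
    simp [apply, reverseSegment, List.take_append, List.drop_append, h₁, h₂]
  | seq p q ihp ihq =>
    simp only [apply]
    rw [ihp hp.1, ihq (by rw [length_apply]; exact hp.2)]
  | par p q ihp ihq =>
    simp only [apply]
    rw [ihp hp.1, ihq (by rw [length_apply]; exact hp.2)]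

end Protocol

/-! ### Tripartite Binary Sort sorts -/

theorem findIdx_true_blocks (a b : ℕ) (S : List Bool) :
    (List.replicate a false ++ List.replicate (b + 1) true ++ S).findIdx (fun b => b) = a := by
  induction a with
  | zero => simp [List.replicate_succ, List.findIdx_cons]
  | succ a ih => simpa [List.replicate_succ, List.findIdx_cons] using ih

theorem findIdx_false_blocks (a b : ℕ) (S : List Bool) :
    (List.replicate a true ++ List.replicate (b + 1) false ++ S).findIdx (fun b => !b) = a := by
  induction a with
  | zero => simp [List.replicate_succ, List.findIdx_cons]
  | succ a ih => simpa [List.replicate_succ, List.findIdx_cons] using ih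

/-- A string `0ᵃ1ᵇ⁺¹0ᵈ⁺¹1ᶠ` is merged by reversing its two middle blocks. -/
theorem mergeStep_blocks (a b d f : ℕ) :
    mergeStep (List.replicate a false ++ List.replicate (b + 1) true ++
      List.replicate (d + 1) false ++ List.replicate f true) = Protocol.rev a (b + d + 2) := by
  have h₁ := findIdx_true_blocks a b (List.replicate (d + 1) false ++ List.replicate f true)
  have h₂ := findIdx_false_blocks f d (List.replicate (b + 1) true ++ List.replicate a false)
  simp only [← List.append_assoc] at h₁ h₂
  have h₃ : (List.replicate a false ++ List.replicate (b + 1) true ++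
      List.replicate (d + 1) false ++ List.replicate f true).reverse =
      List.replicate f true ++ List.replicate (d + 1) false ++ List.replicate (b + 1) true ++
        List.replicate a false := by
    simp only [List.reverse_append, List.reverse_replicate, List.append_assoc]
  simp only [mergeStep, h₁, h₃, h₂, List.length_append, List.length_replicate]
  rw [if_pos (by omega)]
  congr 1
  omega

theorem mergeStep_sorted (a b : ℕ) :
    mergeStep (List.replicate a false ++ List.replicate b true) = Protocol.idle := by
  have h₃ : (List.replicate a false ++ List.replicate b true).reverse =
      List.replicate b true ++ List.replicate a false := by simp
  unfold mergeStep
  refine if_neg ?_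
  rw [h₃]
  rcases b with _ | b
  · have : List.findIdx (fun b => b) (List.replicate a false) = a := by
      induction a with
      | zero => rfl
      | succ a ih => simp only [List.replicate_succ, List.findIdx_cons]; simpa using ih (by simp)
    simp only [List.replicate_zero, List.append_nil, this, List.length_replicate]; omega
  · rcases a with _ | a
    · have : List.findIdx (fun b => !b) (List.replicate (b + 1) true) = b + 1 := by
        generalize b + 1 = k
        induction k with
        | zero => rfl
        | succ a ih => simp only [List.replicate_succ, List.findIdx_cons]; simpa using ih
      simp [this]
    · have h₁ := findIdx_true_blocks (a + 1) b []
      have h₂ := findIdx_false_blocks (b + 1) a []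
      rw [List.append_nil] at h₁ h₂
      rw [h₁, h₂]
      simp

theorem mergeStep_fits (B : List Bool) : (mergeStep B).Fits B.length := by
  unfold mergeStep
  dsimp only
  split_ifs with h
  · simp only [Protocol.Fits]; omega
  · trivial

theorem mergeStep_apply_blocks (a b d f : ℕ) :
    let S := List.replicate a false ++ List.replicate b true ++
      List.replicate d false ++ List.replicate f true
    (mergeStep S).apply S = List.replicate (a + d) false ++ List.replicate (b + f) true := by
  intro S
  rcases b with _ | b
  · have : S = List.replicate (a + d) false ++ List.replicate (0 + f) true := by
      simp only [S, List.replicate_zero, List.append_nil, List.replicate_append_replicate,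
        Nat.zero_add]
    rw [this, mergeStep_sorted]; rfl
  rcases d with _ | d
  · have : S = List.replicate (a + 0) false ++ List.replicate (b + 1 + f) true := by
      simp [S]
    rw [this, mergeStep_sorted]; rfl
  · have hS : S = List.replicate a false ++ (List.replicate (b + 1) true ++
      List.replicate (d + 1) false) ++ List.replicate f true := by simp [S]
    have hl : (List.replicate (b + 1) true ++ List.replicate (d + 1) false).length =
      b + d + 2 := by simp; omega
    rw [show mergeStep S = _ from mergeStep_blocks a b d f, Protocol.apply, reverseSegment, hS,
      List.append_assoc (List.replicate a false), List.take_left' List.length_replicate,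
      List.drop_left' List.length_replicate, List.take_left' hl, List.drop_left' hl,
      List.reverse_append, List.reverse_replicate, List.reverse_replicate, ← List.append_assoc,
      List.replicate_append_replicate, List.append_assoc, List.replicate_append_replicate]

theorem mergeStep_time_le (B : List Bool) : (mergeStep B).time ≤ ((B.length : ℝ) + 1) / 3 := by
  unfold mergeStep
  dsimp only
  split_ifs with h
  · simp only [Protocol.time]
    have : B.length - 1 - B.reverse.findIdx (fun b => !b) + 1 - B.findIdx (fun b => b) ≤
      B.length := by omega
    have : ((B.length - 1 - B.reverse.findIdx (fun b => !b) + 1 - B.findIdx (fun b => b) : ℕ) : ℝ)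
      ≤ B.length := by exact_mod_cast this
    linarith
  · simp only [Protocol.time]; positivity

theorem par_apply_append {α : Type*} {p q r : Protocol} {A M : List α} (C : List α)
    (hp : p.Fits A.length) (hq : q.Fits M.length) :
    (Protocol.par p (Protocol.par (q.shift A.length) (r.shift (A.length + M.length)))).apply
      (A ++ M ++ C) = p.apply A ++ q.apply M ++ r.apply C := by
  have h₁ : (p.apply A).length = A.length := p.length_apply A
  have h₂ : (p.apply A ++ q.apply M).length = A.length + M.length := by
    simp [Protocol.length_apply]
  simp only [Protocol.apply]
  rw [List.append_assoc, hp.apply_append, ← h₁, Protocol.apply_shift, hq.apply_append,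
    ← List.append_assoc, h₁, ← h₂, Protocol.apply_shift]

/-- The first of the three segments into which Tripartite Binary Sort cuts a string. -/
def ThirdsRule.left (c : ThirdsRule) (B : List Bool) : List Bool := B.take (c.fst B.length)

/-- The second of the three segments into which Tripartite Binary Sort cuts a string. -/
def ThirdsRule.mid (c : ThirdsRule) (B : List Bool) : List Bool :=
  (B.take (c.snd B.length)).drop (c.fst B.length)

/-- The third of the three segments into which Tripartite Binary Sort cuts a string. -/
def ThirdsRule.right (c : ThirdsRule) (B : List Bool) : List Bool := B.drop (c.snd B.length)

namespace ThirdsRule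

variable (c : ThirdsRule) {B : List Bool}

theorem length_left (hB : 2 ≤ B.length) : (c.left B).length = c.fst B.length := by
  have := c.fst_le_snd _ hB
  have := c.snd_le _ hB
  rw [left, List.length_take]; omega

theorem length_mid (hB : 2 ≤ B.length) :
    (c.mid B).length = c.snd B.length - c.fst B.length := by
  have := c.snd_le _ hB
  rw [mid, List.length_drop, List.length_take]; omega

theorem length_right : (c.right B).length = B.length - c.snd B.length := by
  rw [right, List.length_drop]

theorem left_append_mid_append_right (hB : 2 ≤ B.length) :
    c.left B ++ c.mid B ++ c.right B = B := by
  have h := c.fst_le_snd _ hB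
  have : c.left B = (B.take (c.snd B.length)).take (c.fst B.length) := by
    rw [List.take_take, min_eq_left h, left]
  rw [this, mid, right, List.take_append_drop, List.take_append_drop]

theorem length_left_lt (hB : 2 ≤ B.length) : (c.left B).length < B.length := by
  have := c.fst_near _ hB
  rw [c.length_left hB]; omega

theorem length_mid_lt (hB : 2 ≤ B.length) : (c.mid B).length < B.length := by
  rw [c.length_mid hB]; exact c.mid_lt _ hB

theorem length_right_lt (hB : 2 ≤ B.length) : (c.right B).length < B.length := by
  have := c.snd_near _ hB
  rw [c.length_right]; omega

end ThirdsRule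

/-- The first stage of Tripartite Binary Sort: the three recursive calls, in parallel. -/
def tbsThirds (c : ThirdsRule) (B : List Bool) : Protocol :=
  Protocol.par (tbs c (c.left B)) (Protocol.par
    ((tbs c ((c.mid B).map (fun b => !b))).shift (c.fst B.length))
    ((tbs c (c.right B)).shift (c.snd B.length)))

theorem tbs_of_length_le (c : ThirdsRule) {B : List Bool} (hB : B.length ≤ 1) :
    tbs c B = Protocol.idle := by
  rw [tbs, dif_pos hB]

theorem tbs_of_two_le (c : ThirdsRule) {B : List Bool} (hB : 2 ≤ B.length) :
    tbs c B = Protocol.seq (tbsThirds c B) (mergeStep ((tbsThirds c B).apply B)) := by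
  rw [tbs, dif_neg (by omega)]
  rfl

theorem count_map_not (b : Bool) (S : List Bool) :
    (S.map (fun b => !b)).count b = S.count (!b) := by
  induction S with
  | nil => rfl
  | cons x S ih => cases x <;> cases b <;> simp_all

/-- The sorted string with as many `0`s and `1`s as `B`. -/
def sortedBits (B : List Bool) : List Bool :=
  List.replicate (B.count false) false ++ List.replicate (B.count true) true

/-- A protocol that sorts the bitwise complement of `M` sorts `M` backwards. -/
theorem apply_of_apply_complement {p : Protocol} {M : List Bool}
    (h : p.apply (M.map (fun b => !b)) = sortedBits (M.map (fun b => !b))) :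
    p.apply M = List.replicate (M.count true) true ++ List.replicate (M.count false) false := by
  have hM : (M.map (fun b => !b)).map (fun b => !b) = M := by
    rw [List.map_map]
    simpa using List.map_id'' (f := (fun b => !b) ∘ fun b => !b) (by simp) M
  conv_lhs => rw [← hM, Protocol.apply_map, h, sortedBits, count_map_not, count_map_not]
  simp

theorem tbsThirds_fits_apply_of_sorted {c : ThirdsRule} {B : List Bool} (hB : 2 ≤ B.length)
    (ih : ∀ S : List Bool, S.length < B.length →
      (tbs c S).Fits S.length ∧ (tbs c S).apply S = sortedBits S) :
    (tbsThirds c B).Fits B.length ∧ (tbsThirds c B).apply B =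
      List.replicate ((c.left B).count false) false ++
      List.replicate ((c.left B).count true + (c.mid B).count true) true ++
      List.replicate ((c.mid B).count false + (c.right B).count false) false ++
      List.replicate ((c.right B).count true) true := by
  obtain ⟨f₁, s₁⟩ := ih _ (c.length_left_lt hB)
  obtain ⟨f₂, s₂⟩ := ih ((c.mid B).map (fun b => !b))
    (by rw [List.length_map]; exact c.length_mid_lt hB)
  obtain ⟨f₃, s₃⟩ := ih _ (c.length_right_lt hB)
  rw [List.length_map] at f₂
  have l₁ := c.length_left hB
  have l₂ := c.length_mid hB
  have l₃ := c.length_right (B := B)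
  have h₁ := c.fst_le_snd _ hB
  have h₂ := c.snd_le _ hB
  constructor
  · refine ⟨f₁.mono (by omega), (f₂.shift _).mono (by omega), (f₃.shift _).mono (by omega)⟩
  · have key := par_apply_append (r := tbs c (c.right B)) (c.right B) f₁ f₂
    rw [show (c.left B).length + (c.mid B).length = c.snd B.length by omega, l₁,
      c.left_append_mid_append_right hB, s₁, apply_of_apply_complement s₂, s₃] at key
    refine Eq.trans key ?_
    simp only [sortedBits, List.replicate_add, List.append_assoc]

/-- Tripartite Binary Sort sorts, and stays within the string. -/
theorem tbs_fits_apply (c : ThirdsRule) (B : List Bool) :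
    (tbs c B).Fits B.length ∧ (tbs c B).apply B = sortedBits B := by
  induction hn : B.length using Nat.strong_induction_on generalizing B with
  | _ n ih =>
    subst hn
    rcases Nat.lt_or_ge B.length 2 with hB | hB
    · rw [tbs_of_length_le c (by omega)]
      refine ⟨trivial, ?_⟩
      rcases B with _ | ⟨b, _ | ⟨b', B⟩⟩
      · rfl
      · cases b <;> rfl
      · simp at hB
    · obtain ⟨hf, ha⟩ := tbsThirds_fits_apply_of_sorted hB (fun S hS => ih _ hS S rfl)
      rw [tbs_of_two_le c hB]
      constructor
      · refine ⟨hf, ?_⟩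
        have := mergeStep_fits ((tbsThirds c B).apply B)
        rwa [Protocol.length_apply] at this
      · rw [Protocol.apply, ha, mergeStep_apply_blocks, sortedBits]
        have h (b : Bool) : B.count b =
            (c.left B).count b + (c.mid B).count b + (c.right B).count b := by
          conv_lhs => rw [← c.left_append_mid_append_right hB]
          rw [List.count_append, List.count_append]
        rw [h, h, ← add_assoc]

theorem tbsThirds_apply (c : ThirdsRule) {B : List Bool} (hB : 2 ≤ B.length) :
    (tbsThirds c B).apply B =
      List.replicate ((c.left B).count false) false ++
      List.replicate ((c.left B).count true + (c.mid B).count true) true ++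
      List.replicate ((c.mid B).count false + (c.right B).count false) false ++
      List.replicate ((c.right B).count true) true :=
  (tbsThirds_fits_apply_of_sorted hB fun S _ => tbs_fits_apply c S).2

theorem tbsThirds_time (c : ThirdsRule) (B : List Bool) :
    (tbsThirds c B).time = max (tbs c (c.left B)).time
      (max (tbs c ((c.mid B).map (fun b => !b))).time (tbs c (c.right B)).time) := by
  simp only [tbsThirds, Protocol.time, Protocol.time_shift]

/-! ### The time of Tripartite Binary Sort on a fixed string -/

/-- A crude bound, for the short strings at which the recursion for the mean squared deviation does
not contract. -/
theorem tbs_time_le_sq (c : ThirdsRule) (B : List Bool) :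
    (tbs c B).time ≤ (B.length : ℝ) ^ 2 := by
  induction hn : B.length using Nat.strong_induction_on generalizing B with
  | _ n ih =>
    subst hn
    rcases Nat.lt_or_ge B.length 2 with hB | hB
    · rw [tbs_of_length_le c (by omega)]
      simp only [Protocol.time]; positivity
    · have key (S : List Bool) (hS : S.length < B.length) :
          (tbs c S).time ≤ ((B.length : ℝ) - 1) ^ 2 := by
        refine (ih _ hS S rfl).trans ?_
        have : (S.length : ℝ) + 1 ≤ B.length := by exact_mod_cast hS
        gcongr
        linarith
      rw [tbs_of_two_le c hB, Protocol.time, tbsThirds_time]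
      have h₁ := max_le (key _ (c.length_left_lt hB)) (max_le (key ((c.mid B).map (fun b => !b))
        (by rw [List.length_map]; exact c.length_mid_lt hB)) (key _ (c.length_right_lt hB)))
      have h₂ := mergeStep_time_le ((tbsThirds c B).apply B)
      rw [Protocol.length_apply] at h₂
      have : (2 : ℝ) ≤ B.length := by exact_mod_cast hB
      nlinarith

/-- The merging step of a string of length `m` takes time close to `2 m / 9`; the error is
controlled by the imbalance of the two outer thirds. -/
theorem abs_mergeStep_time_sub_le (c : ThirdsRule) {B : List Bool} (hB : 2 ≤ B.length) :
    |(mergeStep ((tbsThirds c B).apply B)).time - 2 * (B.length : ℝ) / 9| ≤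
      2 * |((c.left B).count true : ℝ) - (c.left B).length / 2| +
      2 * |((c.right B).count true : ℝ) - (c.right B).length / 2| + 1 := by
  have l₁ := c.length_left hB
  have l₂ := c.length_mid hB
  have l₃ := c.length_right (B := B)
  have h₁ := c.fst_le_snd _ hB
  have h₂ := c.snd_le _ hB
  have n₁ := c.fst_near _ hB
  have n₂ := c.snd_near _ hB
  have c₂ := List.count_true_add_count_false (c.mid B)
  have c₃ := List.count_true_add_count_false (c.right B)
  rw [tbsThirds_apply c hB]
  generalize (c.left B).count true = b at *
  generalize (c.left B).count false = a at *
  generalize (c.mid B).count true = x at *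
  generalize (c.mid B).count false = y at *
  generalize (c.right B).count false = e at *
  generalize (c.right B).count true = f at *
  generalize (c.left B).length = M₁ at *
  generalize (c.mid B).length = M₂ at *
  generalize (c.right B).length = M₃ at *
  generalize B.length = m at *
  have e₁ : (M₁ : ℝ) + M₂ + M₃ = m := by norm_cast; omega
  have e₂ : (x : ℝ) + y = M₂ := by exact_mod_cast c₂
  have e₃ : (f : ℝ) + e = M₃ := by exact_mod_cast c₃
  have e₄ : (m : ℝ) ≤ 3 * M₁ + 3 := by norm_cast; omega
  have e₅ : 3 * (M₁ : ℝ) ≤ m + 3 := by norm_cast; omega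
  have e₆ : (m : ℝ) ≤ 3 * M₃ + 3 := by norm_cast; omega
  have e₇ : 3 * (M₃ : ℝ) ≤ m + 3 := by norm_cast; omega
  have a₁ := neg_abs_le ((b : ℝ) - M₁ / 2)
  have a₂ := le_abs_self ((b : ℝ) - M₁ / 2)
  have a₃ := neg_abs_le ((f : ℝ) - M₃ / 2)
  have a₄ := le_abs_self ((f : ℝ) - M₃ / 2)
  have hm : (2 : ℝ) ≤ m := by exact_mod_cast hB
  by_cases hbe : b + x = 0 ∨ y + e = 0
  · -- Nothing is reversed, but one of the outer thirds is constant, so its imbalance is large.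
    have ht : mergeStep (List.replicate a false ++ List.replicate (b + x) true ++
        List.replicate (y + e) false ++ List.replicate f true) = Protocol.idle := by
      rcases hbe with h | h
      · rw [h, List.replicate_zero, List.append_nil, List.replicate_append_replicate,
          mergeStep_sorted]
      · rw [h, List.replicate_zero, List.append_nil, List.append_assoc,
          List.replicate_append_replicate, mergeStep_sorted]
    rw [ht, Protocol.time, zero_sub, abs_neg, abs_of_nonneg (by positivity)]
    have hbe' : (b : ℝ) ≤ 0 ∨ (e : ℝ) ≤ 0 := by norm_cast; omega
    rcases hbe' with h | h <;>
      linarith [abs_nonneg ((b : ℝ) - M₁ / 2), abs_nonneg ((f : ℝ) - M₃ / 2)]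
  · obtain ⟨u, hu⟩ : ∃ u, b + x = u + 1 := ⟨b + x - 1, by omega⟩
    obtain ⟨v, hv⟩ : ∃ v, y + e = v + 1 := ⟨y + e - 1, by omega⟩
    rw [hu, hv, mergeStep_blocks, Protocol.time]
    have hu' : (b : ℝ) + x = u + 1 := by exact_mod_cast hu
    have hv' : (y : ℝ) + e = v + 1 := by exact_mod_cast hv
    push_cast
    rw [abs_le]
    constructor <;> linarith [abs_nonneg ((b : ℝ) - M₁ / 2), abs_nonneg ((f : ℝ) - M₃ / 2)]

theorem sq_max_sub_le (a b x y : ℝ) :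
    (max a b - max x y) ^ 2 ≤ (a - x) ^ 2 + (b - y) ^ 2 := by
  have h := abs_max_sub_max_le_max a b x y
  rw [← sq_abs, ← sq_abs (a - x), ← sq_abs (b - y)]
  rcases le_total |a - x| |b - y| with h' | h'
  · rw [max_eq_right h'] at h
    nlinarith [abs_nonneg (max a b - max x y), sq_nonneg |a - x|]
  · rw [max_eq_left h'] at h
    nlinarith [abs_nonneg (max a b - max x y), sq_nonneg |b - y|]

/-- A weighted form of `(x + y) ^ 2 ≤ 2 * x ^ 2 + 2 * y ^ 2`; the coefficient of `x ^ 2` is below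
`4 / 3`, which makes the recursions below contract. -/
theorem add_sq_le_weighted (x y : ℝ) : (x + y) ^ 2 ≤ 7 / 6 * x ^ 2 + 7 * y ^ 2 := by
  nlinarith [sq_nonneg (x - 6 * y)]

/-- The squared deviation of the time of Tripartite Binary Sort from `m / 3` is bounded by the
squared deviations of the three recursive calls and the imbalances of the outer thirds. -/
theorem tbs_time_sub_sq_le (c : ThirdsRule) {B : List Bool} (hB : 2 ≤ B.length) :
    ((tbs c B).time - (B.length : ℝ) / 3) ^ 2 ≤
      7 / 6 * (((tbs c (c.left B)).time - ((c.left B).length : ℝ) / 3) ^ 2 +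
        (((tbs c ((c.mid B).map (fun b => !b))).time - ((c.mid B).length : ℝ) / 3) ^ 2 +
        ((tbs c (c.right B)).time - ((c.right B).length : ℝ) / 3) ^ 2)) +
      84 * ((((c.left B).count true : ℝ) - (c.left B).length / 2) ^ 2 +
        (((c.right B).count true : ℝ) - (c.right B).length / 2) ^ 2 + 1) := by
  have hm := abs_mergeStep_time_sub_le c hB
  rw [tbs_of_two_le c hB, Protocol.time, tbsThirds_time]
  have l₁ := c.length_left hB
  have l₂ := c.length_mid hB
  have l₃ := c.length_right (B := B)
  have h₁ := c.fst_le_snd _ hB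
  have h₂ := c.snd_le _ hB
  have n₁ := c.fst_near _ hB
  have n₂ := c.snd_near _ hB
  generalize (mergeStep ((tbsThirds c B).apply B)).time = g at *
  generalize (tbs c (c.left B)).time = t₁
  generalize (tbs c ((c.mid B).map (fun b => !b))).time = t₂
  generalize (tbs c (c.right B)).time = t₃
  generalize ((c.left B).count true : ℝ) = b at *
  generalize ((c.right B).count true : ℝ) = f at *
  generalize (c.left B).length = M₁ at *
  generalize (c.mid B).length = M₂ at *
  generalize (c.right B).length = M₃ at *
  generalize B.length = m at *
  have e₄ : (m : ℝ) ≤ 3 * M₁ + 6 := by norm_cast; omega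
  have e₅ : 3 * (M₁ : ℝ) ≤ m + 6 := by norm_cast; omega
  have e₆ : (m : ℝ) ≤ 3 * M₃ + 6 := by norm_cast; omega
  have e₇ : 3 * (M₃ : ℝ) ≤ m + 6 := by norm_cast; omega
  have e₈ : (m : ℝ) ≤ 3 * M₂ + 6 := by norm_cast; omega
  have e₉ : 3 * (M₂ : ℝ) ≤ m + 6 := by norm_cast; omega
  set μ : ℝ := max ((M₁ : ℝ) / 3) (max ((M₂ : ℝ) / 3) ((M₃ : ℝ) / 3)) with hμ
  set τ : ℝ := max t₁ (max t₂ t₃)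
  have hμ₁ : μ ≤ (m : ℝ) / 9 + 2 / 3 := max_le (by linarith) (max_le (by linarith) (by linarith))
  have hμ₂ : (m : ℝ) / 9 - 2 / 3 ≤ μ := le_trans (by linarith) (le_max_left _ _)
  have hτ : (τ - μ) ^ 2 ≤ (t₁ - M₁ / 3) ^ 2 + ((t₂ - M₂ / 3) ^ 2 + (t₃ - M₃ / 3) ^ 2) :=
    (sq_max_sub_le _ _ _ _).trans (by gcongr; exact sq_max_sub_le _ _ _ _)
  have hrest : |μ + g - m / 3| ≤ 2 * |b - M₁ / 2| + 2 * |f - M₃ / 2| + 2 := by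
    obtain ⟨p, q⟩ := abs_le.mp hm
    exact abs_le.mpr ⟨by linarith, by linarith⟩
  have hsq : (μ + g - m / 3) ^ 2 ≤ 12 * ((b - M₁ / 2) ^ 2 + (f - M₃ / 2) ^ 2 + 1) := by
    rw [← sq_abs, ← sq_abs (b - M₁ / 2), ← sq_abs (f - M₃ / 2)]
    refine (pow_le_pow_left₀ (abs_nonneg _) hrest 2).trans ?_
    nlinarith [sq_nonneg (|b - M₁ / 2| - |f - M₃ / 2|), sq_nonneg (|b - M₁ / 2| - 1),
      sq_nonneg (|f - M₃ / 2| - 1)]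
  have hw := add_sq_le_weighted (τ - μ) (μ + g - m / 3)
  rw [show τ - μ + (μ + g - m / 3) = τ + g - m / 3 by ring] at hw
  linarith

/-! ### The mean squared deviation of Tripartite Binary Sort -/

/-- The family `B`, seen as a random string of length `m` with the uniform distribution on `Ω`,
is balanced: in every window the number of `1`s differs from half the length of the window by at
most the standard deviation of fair coin tosses, in mean square.  This passes to substrings
and to complements, and it requires no independence. -/
def BalancedFamily {Ω : Type*} [Fintype Ω] (m : ℕ) (B : Ω → List Bool) : Prop :=
  (∀ ω, (B ω).length = m) ∧ ∀ s l, s + l ≤ m →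
    ∑ ω, (((((B ω).drop s).take l).count true : ℝ) - l / 2) ^ 2 ≤ (l : ℝ) / 4 * Fintype.card Ω

namespace BalancedFamily

variable {Ω : Type*} [Fintype Ω] {m : ℕ} {B : Ω → List Bool}

theorem window (hB : BalancedFamily m B) {s k : ℕ} (h : s + k ≤ m) :
    BalancedFamily k (fun ω => ((B ω).drop s).take k) := by
  refine ⟨fun ω => ?_, fun s' l' h' => ?_⟩
  · rw [List.length_take, List.length_drop, hB.1]; omega
  · have := hB.2 (s + s') l' (by omega)
    convert this using 6 with ω
    rw [List.drop_take, List.take_take, List.drop_drop, min_eq_left (by omega)]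

theorem complement (hB : BalancedFamily m B) :
    BalancedFamily m (fun ω => (B ω).map (fun b => !b)) := by
  refine ⟨fun ω => by rw [List.length_map, hB.1], fun s l h => ?_⟩
  refine le_of_eq_of_le (Finset.sum_congr rfl fun ω _ => ?_) (hB.2 s l h)
  rw [← List.map_drop, ← List.map_take, count_map_not]
  have h₁ := List.count_true_add_count_false (((B ω).drop s).take l)
  rw [List.length_take, List.length_drop, hB.1, min_eq_left (by omega)] at h₁
  have h₂ : (((((B ω).drop s).take l).count true : ℝ)) +
    (((B ω).drop s).take l).count false = l := by exact_mod_cast h₁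
  rw [← h₂, Bool.not_true]
  ring

theorem sum_sq_count_le (hB : BalancedFamily m B) :
    ∑ ω, (((B ω).count true : ℝ) - m / 2) ^ 2 ≤ (m : ℝ) / 4 * Fintype.card Ω := by
  refine le_of_eq_of_le (Finset.sum_congr rfl fun ω _ => ?_) (hB.2 0 m (by omega))
  rw [List.drop_zero, List.take_of_length_le (hB.1 ω).le]

end BalancedFamily

/-- The contraction of the recursions: if the parts `x` of `y` are at most `9 / 16 * y`, which is
`(3 / 4) ^ 2 * y`, then `x * √x` summed over them is at most `3 / 4 * (y * √y)`. -/
theorem mul_sqrt_le_of_le {x y : ℝ} (hx : 0 ≤ x) (h : x ≤ 9 / 16 * y) :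
    x * √x ≤ 3 / 4 * √y * x := by
  have : √x ≤ 3 / 4 * √y := by
    refine (Real.sqrt_le_sqrt h).trans_eq ?_
    rw [Real.sqrt_mul (by norm_num), show (9 / 16 : ℝ) = (3 / 4) ^ 2 by norm_num,
      Real.sqrt_sq (by norm_num)]
  nlinarith

theorem self_le_mul_sqrt_natCast (m : ℕ) : (m : ℝ) ≤ m * √m := by
  rcases Nat.eq_zero_or_pos m with rfl | h
  · simp
  · have : (1 : ℝ) ≤ √m := Real.one_le_sqrt.mpr (by exact_mod_cast h)
    have : (0 : ℝ) ≤ m := by positivity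
    nlinarith

/-- On a balanced random string of length `m`, the time of Tripartite Binary Sort deviates from
`m / 3` by `O(m ^ (3 / 4))` in root mean square. -/
theorem sum_tbs_time_sub_sq_le (c : ThirdsRule) {Ω : Type*} [Fintype Ω] {m : ℕ}
    {B : Ω → List Bool} (hB : BalancedFamily m B) :
    ∑ ω, ((tbs c (B ω)).time - (m : ℝ) / 3) ^ 2 ≤ 512 * (m * √m) * Fintype.card Ω := by
  induction m using Nat.strong_induction_on generalizing B with
  | _ m ih =>
  rcases Nat.lt_or_ge m 9 with hm | hm
  · have key (ω : Ω) : ((tbs c (B ω)).time - (m : ℝ) / 3) ^ 2 ≤ 512 * (m * √m) := by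
      have h₁ := tbs_time_le_sq c (B ω)
      have h₂ := (tbs c (B ω)).time_nonneg
      rw [hB.1] at h₁
      have h₃ : (m : ℝ) / 3 ≤ (m : ℝ) ^ 2 := by
        have : (m : ℝ) ≤ (m : ℝ) ^ 2 := by exact_mod_cast Nat.le_self_pow (by norm_num) m
        linarith [show (0 : ℝ) ≤ m by positivity]
      have h₄ : ((tbs c (B ω)).time - (m : ℝ) / 3) ^ 2 ≤ ((m : ℝ) ^ 2) ^ 2 :=
        sq_le_sq' (by linarith) (by linarith [show (0 : ℝ) ≤ m by positivity])
      have h₅ : ((m : ℝ) ^ 2) ^ 2 ≤ 512 * m := by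
        have : (m ^ 2) ^ 2 ≤ 512 * m := by interval_cases m <;> norm_num
        exact_mod_cast this
      linarith [self_le_mul_sqrt_natCast m]
    calc _ ≤ ∑ _ω : Ω, 512 * ((m : ℝ) * √m) := Finset.sum_le_sum fun ω _ => key ω
      _ = _ := by rw [Finset.sum_const, nsmul_eq_mul, Finset.card_univ]; ring
  · have h₁ := c.fst_le_snd m (by omega)
    have h₂ := c.snd_le m (by omega)
    have n₁ := c.fst_near m (by omega)
    have n₂ := c.snd_near m (by omega)
    have hL : BalancedFamily (c.fst m) (fun ω => c.left (B ω)) := by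
      have := hB.window (s := 0) (k := c.fst m) (by omega)
      simpa only [ThirdsRule.left, hB.1, List.drop_zero] using this
    have hM : BalancedFamily (c.snd m - c.fst m) (fun ω => c.mid (B ω)) := by
      have := hB.window (s := c.fst m) (k := c.snd m - c.fst m) (by omega)
      simpa only [ThirdsRule.mid, hB.1, List.drop_take] using this
    have hR : BalancedFamily (m - c.snd m) (fun ω => c.right (B ω)) := by
      have := hB.window (s := c.snd m) (k := m - c.snd m) (by omega)
      have e (ω : Ω) : ((B ω).drop (c.snd m)).take (m - c.snd m) = (B ω).drop (c.snd m) :=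
        List.take_of_length_le (by rw [List.length_drop, hB.1])
      simpa only [ThirdsRule.right, hB.1, e] using this
    have iL := ih _ (by omega) hL
    have iM := ih _ (by omega) hM.complement
    have iR := ih _ (by omega) hR
    have vL := hL.sum_sq_count_le
    have vR := hR.sum_sq_count_le
    have hsum := Finset.sum_le_sum fun ω (_ : ω ∈ Finset.univ) =>
      tbs_time_sub_sq_le c (B := B ω) (by rw [hB.1]; omega)
    simp only [hB.1, hL.1, hM.1, hR.1, Finset.sum_add_distrib, ← Finset.mul_sum,
      Finset.sum_const, nsmul_eq_mul, Finset.card_univ, mul_one] at hsum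
    set N : ℝ := (Fintype.card Ω : ℝ)
    have hN : 0 ≤ N := by positivity
    generalize c.fst m = M₁ at *
    generalize hM₂ : c.snd m - M₁ = M₂ at *
    generalize hM₃ : m - c.snd m = M₃ at *
    have e₁ : (M₁ : ℝ) + M₂ + M₃ = m := by norm_cast; omega
    have q₁ := mul_sqrt_le_of_le (x := M₁) (y := m) (by positivity)
      (by have : (16 : ℝ) * M₁ ≤ 9 * m := by { norm_cast; omega }
          linarith)
    have q₂ := mul_sqrt_le_of_le (x := M₂) (y := m) (by positivity)
      (by have : (16 : ℝ) * M₂ ≤ 9 * m := by { norm_cast; omega }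
          linarith)
    have q₃ := mul_sqrt_le_of_le (x := M₃) (y := m) (by positivity)
      (by have : (16 : ℝ) * M₃ ≤ 9 * m := by { norm_cast; omega }
          linarith)
    have q : (M₁ : ℝ) * √M₁ + M₂ * √M₂ + M₃ * √M₃ ≤ 3 / 4 * (m * √m) := by
      have : 3 / 4 * √m * M₁ + 3 / 4 * √m * M₂ + 3 / 4 * √m * M₃ = 3 / 4 * ((m : ℝ) * √m) := by
        rw [← e₁]; ring
      linarith
    have r : 84 * ((M₁ : ℝ) / 4 + M₃ / 4 + 1) ≤ 64 * (m * √m) := by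
      have : (9 : ℝ) ≤ m := by exact_mod_cast hm
      linarith [self_le_mul_sqrt_natCast m, show (0 : ℝ) ≤ M₂ by positivity]
    have q' := mul_le_mul_of_nonneg_right q hN
    have r' := mul_le_mul_of_nonneg_right r hN
    linarith

/-! ### Uniformly random permutations as sequences -/

/-- The permutation `σ`, as a sequence of the numbers `a, …, a + m - 1`. -/
def permList (a : ℕ) {m : ℕ} (σ : Equiv.Perm (Fin m)) : List ℕ :=
  List.ofFn (fun i => a + (σ i : ℕ))

theorem length_permList (a : ℕ) {m : ℕ} (σ : Equiv.Perm (Fin m)) :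
    (permList a σ).length = m := List.length_ofFn

theorem perm_range'_iff {a m : ℕ} {L : List ℕ} :
    L.Perm (List.range' a m) ↔ L.length = m ∧ L.Nodup ∧ ∀ v ∈ L, a ≤ v ∧ v < a + m := by
  constructor
  · intro h
    refine ⟨by rw [h.length_eq, List.length_range'], h.nodup_iff.mpr List.nodup_range',
      fun v hv => ?_⟩
    simpa [List.mem_range'_1] using h.mem_iff.mp hv
  · rintro ⟨h₁, h₂, h₃⟩
    refine (List.subperm_of_subset h₂ fun v hv => ?_).perm_of_length_le
      (by rw [h₁, List.length_range'])
    simpa [List.mem_range'_1] using h₃ v hv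

theorem permList_perm_range' (a : ℕ) {m : ℕ} (σ : Equiv.Perm (Fin m)) :
    (permList a σ).Perm (List.range' a m) := by
  refine perm_range'_iff.mpr ⟨length_permList a σ, ?_, fun v hv => ?_⟩
  · refine List.nodup_ofFn.mpr fun i j h => σ.injective (Fin.ext ?_)
    simpa using h
  · obtain ⟨i, rfl⟩ := List.mem_ofFn.mp hv
    have := (σ i).isLt
    omega

theorem exists_eq_permList {a m : ℕ} {L : List ℕ} (h : L.Perm (List.range' a m)) :
    ∃ σ : Equiv.Perm (Fin m), L = permList a σ := by
  obtain ⟨h₁, h₂, h₃⟩ := perm_range'_iff.mp h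
  subst h₁
  have hb (i : Fin L.length) : a ≤ L[i] ∧ L[i] < a + L.length := h₃ _ (List.getElem_mem _)
  let f : Fin L.length → Fin L.length := fun i => ⟨L[i] - a, by have := hb i; omega⟩
  have hf : Function.Injective f := by
    intro i j hij
    have h := congrArg Fin.val hij
    simp only [f] at h
    have := hb i
    have := hb j
    exact Fin.ext (h₂.getElem_inj_iff.mp (show L[i] = L[j] by omega))
  refine ⟨Equiv.ofBijective f (Finite.injective_iff_bijective.mp hf), ?_⟩
  refine List.ext_getElem (by rw [length_permList]) fun i h₁ h₂ => ?_
  have := hb ⟨i, h₁⟩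
  simp only [permList, List.getElem_ofFn, Equiv.ofBijective_apply, f, Fin.getElem_fin] at *
  omega

/-- The relabelling of the numbers `a, …, a + m - 1` by `τ`; other numbers are unchanged. -/
def relabel (a : ℕ) {m : ℕ} (τ : Equiv.Perm (Fin m)) (v : ℕ) : ℕ :=
  if h : a ≤ v ∧ v < a + m then a + (τ ⟨v - a, by omega⟩ : ℕ) else v

theorem relabel_mem_iff (a : ℕ) {m : ℕ} (τ : Equiv.Perm (Fin m)) (v : ℕ) :
    (a ≤ relabel a τ v ∧ relabel a τ v < a + m) ↔ a ≤ v ∧ v < a + m := by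
  unfold relabel
  split_ifs with h
  · have := (τ ⟨v - a, by omega⟩).isLt
    simp only [h, and_self, iff_true]
    omega
  · rfl

theorem relabel_of_notMem {a m : ℕ} (τ : Equiv.Perm (Fin m)) {v : ℕ}
    (h : ¬(a ≤ v ∧ v < a + m)) : relabel a τ v = v := dif_neg h

theorem relabel_injective (a : ℕ) {m : ℕ} (τ : Equiv.Perm (Fin m)) :
    Function.Injective (relabel a τ) := by
  intro v w hvw
  have hv := relabel_mem_iff a τ v
  have hw := relabel_mem_iff a τ w
  rw [← hvw] at hw
  by_cases h : a ≤ v ∧ v < a + m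
  · have h' := hw.mp (hv.mpr h)
    rw [relabel, relabel, dif_pos h, dif_pos h'] at hvw
    have := τ.injective (Fin.ext (Nat.add_left_cancel hvw))
    have := congrArg Fin.val this
    simp only at this
    omega
  · have h' : ¬(a ≤ w ∧ w < a + m) := fun h' => h (hv.mp (hw.mpr h'))
    rwa [relabel_of_notMem τ h, relabel_of_notMem τ h'] at hvw

theorem permList_mul (a : ℕ) {m : ℕ} (τ σ : Equiv.Perm (Fin m)) :
    permList a (τ * σ) = (permList a σ).map (relabel a τ) := by
  rw [permList, permList, List.map_ofFn]
  congr 1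
  funext i
  have := (σ i).isLt
  rw [Function.comp_apply, relabel, dif_pos (by omega)]
  simp

/-- Relabelling a subinterval of the values is multiplication by a permutation. -/
theorem exists_permList_mul_eq_map_relabel {lo n a m : ℕ} (h₁ : lo ≤ a) (h₂ : a + m ≤ lo + n)
    (τ : Equiv.Perm (Fin m)) :
    ∃ τ' : Equiv.Perm (Fin n), ∀ π : Equiv.Perm (Fin n),
      permList lo (τ' * π) = (permList lo π).map (relabel a τ) := by
  have hp : ((List.range' lo n).map (relabel a τ)).Perm (List.range' lo n) := by
    refine perm_range'_iff.mpr ⟨by simp, List.Nodup.map (relabel_injective a τ) List.nodup_range', ?_⟩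
    intro w hw
    obtain ⟨v, hv, rfl⟩ := List.mem_map.mp hw
    rw [List.mem_range'_1] at hv
    by_cases h : a ≤ v ∧ v < a + m
    · have := (relabel_mem_iff a τ v).mpr h
      omega
    · rwa [relabel_of_notMem τ h]
  obtain ⟨τ', hτ'⟩ := exists_eq_permList hp
  refine ⟨τ', fun π => ?_⟩
  rw [permList, permList, List.map_ofFn]
  congr 1
  funext i
  have hl : (π i : ℕ) < ((List.range' lo n).map (relabel a τ)).length := by simp
  have hi : ((List.range' lo n).map (relabel a τ))[(π i : ℕ)] =
      (permList lo τ')[(π i : ℕ)]'(by rw [length_permList]; exact (π i).isLt) := by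
    simp only [hτ']
  simp only [List.getElem_map, List.getElem_range', permList, List.getElem_ofFn] at hi
  simpa using hi.symm

/-- If a sequence `H π` built from a uniformly random permutation `π` runs over permutations of
`a, …, a + m - 1` and is equivariant under relabelling these numbers, then it is uniformly
distributed. -/
theorem factorial_mul_sum_eq_of_equivariant {n a m : ℕ} (H : Equiv.Perm (Fin n) → List ℕ)
    (hH : ∀ π, (H π).Perm (List.range' a m))
    (hτ : ∀ τ : Equiv.Perm (Fin m), ∃ τ' : Equiv.Perm (Fin n),
      ∀ π, H (τ' * π) = (H π).map (relabel a τ)) (F : List ℕ → ℝ) :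
    (m ! : ℝ) * ∑ π, F (H π) = (n ! : ℝ) * ∑ τ : Equiv.Perm (Fin m), F (permList a τ) := by
  choose σ hσ using fun π => exists_eq_permList (hH π)
  choose T hT using hτ
  calc (m ! : ℝ) * ∑ π, F (H π)
      = ∑ _τ : Equiv.Perm (Fin m), ∑ π, F (H π) := by
        rw [Finset.sum_const, nsmul_eq_mul, Finset.card_univ, Fintype.card_perm, Fintype.card_fin]
    _ = ∑ τ : Equiv.Perm (Fin m), ∑ π, F (H (T τ * π)) :=
        Finset.sum_congr rfl fun τ _ => (Equiv.sum_comp (Equiv.mulLeft (T τ)) fun π => F (H π)).symm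
    _ = ∑ π, ∑ τ : Equiv.Perm (Fin m), F (permList a (τ * σ π)) := by
        rw [Finset.sum_comm]
        refine Finset.sum_congr rfl fun π _ => Finset.sum_congr rfl fun τ _ => ?_
        rw [hT, hσ π, permList_mul]
    _ = ∑ _π : Equiv.Perm (Fin n), ∑ τ : Equiv.Perm (Fin m), F (permList a τ) :=
        Finset.sum_congr rfl fun π _ =>
          Equiv.sum_comp (Equiv.mulRight (σ π)) fun τ => F (permList a τ)
    _ = _ := by
        rw [Finset.sum_const, nsmul_eq_mul, Finset.card_univ, Fintype.card_perm, Fintype.card_fin]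

/-! ### The binary labeling of a random permutation is balanced -/

/-- Two distinct positions of a random arrangement of signs `± 1 / 2` with total `0` or `1 / 2` are
negatively correlated. -/
theorem sum_perm_mul_nonpos {n : ℕ} {y : Fin n → ℝ} (hy : ∀ v, y v = 1 / 2 ∨ y v = -(1 / 2))
    (h₀ : 0 ≤ ∑ v, y v) (h₁ : ∑ v, y v ≤ 1 / 2) {i j : Fin n} (hij : i ≠ j) :
    ∑ π : Equiv.Perm (Fin n), y (π i) * y (π j) ≤ 0 := by
  set s := ∑ π : Equiv.Perm (Fin n), y (π i) * y (π j)
  -- Exchanging `j` with any other position `l ≠ i` leaves the sum unchanged.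
  have hswap : ∀ l ∈ Finset.univ.erase i,
      ∑ π : Equiv.Perm (Fin n), y (π i) * y (π l) = s := by
    intro l hl
    have hil : i ≠ l := (Finset.ne_of_mem_erase hl).symm
    rw [← Equiv.sum_comp (Equiv.mulRight (Equiv.swap j l))]
    refine Finset.sum_congr rfl fun π _ => ?_
    simp [Equiv.swap_apply_of_ne_of_ne hij hil]
  have hsum : ((Finset.univ.erase i).card : ℝ) * s =
      ∑ π : Equiv.Perm (Fin n), y (π i) * (∑ v, y v - y (π i)) := by
    rw [← nsmul_eq_mul, ← Finset.sum_const, ← Finset.sum_congr rfl hswap, Finset.sum_comm]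
    refine Finset.sum_congr rfl fun π _ => ?_
    rw [← Finset.mul_sum, ← Equiv.sum_comp π y, ← Finset.add_sum_erase _ _ (Finset.mem_univ i),
      add_sub_cancel_left]
  have hle : ∑ π : Equiv.Perm (Fin n), y (π i) * (∑ v, y v - y (π i)) ≤ 0 := by
    refine Finset.sum_nonpos fun π _ => ?_
    rcases hy (π i) with h | h <;> rw [h] <;> linarith
  have hpos : 0 < ((Finset.univ.erase i).card : ℝ) := by
    exact_mod_cast Finset.card_pos.mpr ⟨j, Finset.mem_erase.mpr ⟨hij.symm, Finset.mem_univ j⟩⟩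
  rw [← hsum] at hle
  exact nonpos_of_mul_nonpos_right hle hpos

/-- The variance of a sum of `l` entries of the random arrangement is at most that of `l` fair
coin tosses. -/
theorem sum_perm_sq_sum_le {n l : ℕ} {y : Fin n → ℝ} (hy : ∀ v, y v = 1 / 2 ∨ y v = -(1 / 2))
    (h₀ : 0 ≤ ∑ v, y v) (h₁ : ∑ v, y v ≤ 1 / 2) {e : Fin l → Fin n}
    (he : Function.Injective e) :
    ∑ π : Equiv.Perm (Fin n), (∑ j, y (π (e j))) ^ 2 ≤ (l : ℝ) / 4 * n ! := by
  have hexp : ∑ π : Equiv.Perm (Fin n), (∑ j, y (π (e j))) ^ 2 =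
      ∑ j, ∑ j', ∑ π : Equiv.Perm (Fin n), y (π (e j)) * y (π (e j')) := by
    simp_rw [sq, Finset.sum_mul_sum]
    rw [Finset.sum_comm]
    exact Finset.sum_congr rfl fun j _ => Finset.sum_comm
  rw [hexp]
  calc _ ≤ ∑ _j : Fin l, (1 / 4 : ℝ) * n ! := by
        refine Finset.sum_le_sum fun j _ => ?_
        rw [← Finset.add_sum_erase _ _ (Finset.mem_univ j)]
        have hd : ∑ π : Equiv.Perm (Fin n), y (π (e j)) * y (π (e j)) = 1 / 4 * n ! := by
          have : ∀ π : Equiv.Perm (Fin n), y (π (e j)) * y (π (e j)) = 1 / 4 := fun π => by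
            rcases hy (π (e j)) with h | h <;> rw [h] <;> norm_num
          simp only [this, Finset.sum_const, nsmul_eq_mul, Finset.card_univ, Fintype.card_perm,
            Fintype.card_fin]
          ring
        have ho : ∑ j' ∈ Finset.univ.erase j,
            ∑ π : Equiv.Perm (Fin n), y (π (e j)) * y (π (e j')) ≤ 0 :=
          Finset.sum_nonpos fun j' hj' =>
            sum_perm_mul_nonpos hy h₀ h₁ fun h => Finset.ne_of_mem_erase hj' (he h).symm
        linarith
    _ = _ := by
        rw [Finset.sum_const, nsmul_eq_mul, Finset.card_univ, Fintype.card_fin]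
        ring

theorem count_true_ofFn_sub {l : ℕ} (f : Fin l → Bool) :
    ((List.ofFn f).count true : ℝ) - l / 2 =
      ∑ j, if f j = true then (1 / 2 : ℝ) else -(1 / 2) := by
  induction l with
  | zero => simp
  | succ l ih =>
    rw [List.ofFn_succ, Fin.sum_univ_succ, ← ih, List.count_cons]
    cases f 0 <;> simp <;> ring

theorem balancedFamily_binaryLabeling (lo n : ℕ) :
    BalancedFamily n (fun π : Equiv.Perm (Fin n) => binaryLabeling lo (permList lo π)) := by
  refine ⟨fun π => by simp [binaryLabeling, length_permList], fun s l hsl => ?_⟩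
  let e : Fin l → Fin n := fun j => ⟨s + j, by have := j.isLt; omega⟩
  have he : Function.Injective e := fun i j h => by
    have := congrArg Fin.val h
    simp only [e] at this
    exact Fin.ext (by omega)
  let y : Fin n → ℝ := fun v => if decide (n / 2 ≤ (v : ℕ)) = true then 1 / 2 else -(1 / 2)
  have hy (v : Fin n) : y v = 1 / 2 ∨ y v = -(1 / 2) := by
    simp only [y]; split_ifs <;> simp
  have hw (π : Equiv.Perm (Fin n)) : ((binaryLabeling lo (permList lo π)).drop s).take l =
      List.ofFn (fun j => decide (n / 2 ≤ (π (e j) : ℕ))) := by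
    refine List.ext_getElem ?_ fun i h₁ h₂ => ?_
    · simp [binaryLabeling, length_permList]; omega
    · simp [binaryLabeling, permList, e]
  have hS : ∑ v, y v = ((n : ℝ) - 2 * (n / 2 : ℕ)) / 2 := by
    have h := Fin.sum_univ_eq_sum_range
      (fun v => if decide (n / 2 ≤ v) = true then (1 / 2 : ℝ) else -(1 / 2)) n
    obtain ⟨d, hd⟩ := Nat.exists_eq_add_of_le (Nat.div_le_self n 2)
    simp only [y]
    rw [h]
    generalize n / 2 = k at *
    subst hd
    rw [Finset.sum_range_add]
    have e₁ : ∑ x ∈ Finset.range k, (if decide (k ≤ x) = true then (1 / 2 : ℝ) else -(1 / 2)) =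
        ∑ _x ∈ Finset.range k, -(1 / 2 : ℝ) := Finset.sum_congr rfl fun x hx => by
      have := Finset.mem_range.mp hx
      rw [if_neg (by simpa using this)]
    rw [e₁]
    simp
    ring
  have hn₁ : (2 : ℝ) * (n / 2 : ℕ) ≤ n := by exact_mod_cast Nat.mul_div_le n 2
  have hn₂ : (n : ℝ) ≤ 2 * (n / 2 : ℕ) + 1 := by norm_cast; omega
  have key := sum_perm_sq_sum_le hy (by rw [hS]; linarith) (by rw [hS]; linarith) he
  rw [Fintype.card_perm, Fintype.card_fin]
  refine le_of_eq_of_le (Finset.sum_congr rfl fun π _ => ?_) key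
  rw [hw, count_true_ofFn_sub]

/-! ### The divide and conquer step -/

/-- The sequence `S` after the first stage of divide and conquer. -/
def firstStage (c : ThirdsRule) (lo : ℕ) (S : List ℕ) : List ℕ :=
  (tbs c (binaryLabeling lo S)).apply S

theorem length_firstStage (c : ThirdsRule) (lo : ℕ) (S : List ℕ) :
    (firstStage c lo S).length = S.length := Protocol.length_apply _ _

theorem length_binaryLabeling (lo : ℕ) (S : List ℕ) :
    (binaryLabeling lo S).length = S.length := List.length_map _

theorem gdc_time_of_two_le (c : ThirdsRule) (lo : ℕ) {S : List ℕ} (hS : 2 ≤ S.length) :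
    (gdc (tbs c) lo S).time = (tbs c (binaryLabeling lo S)).time +
      max (gdc (tbs c) lo ((firstStage c lo S).take (S.length / 2))).time
        (gdc (tbs c) (lo + S.length / 2) ((firstStage c lo S).drop (S.length / 2))).time := by
  rw [gdc, dif_neg (by omega)]
  simp only [Protocol.time, Protocol.time_shift, firstStage]

/-- A crude bound, for the short sequences at which the recursion for the mean squared deviation
does not contract. -/
theorem gdc_time_le_cube (c : ThirdsRule) (lo : ℕ) (S : List ℕ) :
    (gdc (tbs c) lo S).time ≤ (S.length : ℝ) ^ 3 := by
  induction hn : S.length using Nat.strong_induction_on generalizing lo S with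
  | _ n ih =>
    subst hn
    rcases Nat.lt_or_ge S.length 2 with hS | hS
    · rw [gdc, dif_pos (by omega)]
      simp only [Protocol.time]; positivity
    · have key (lo' : ℕ) (R : List ℕ) (hR : R.length < S.length) :
          (gdc (tbs c) lo' R).time ≤ ((S.length : ℝ) - 1) ^ 3 := by
        refine (ih _ hR lo' R rfl).trans ?_
        have : (R.length : ℝ) + 1 ≤ S.length := by exact_mod_cast hR
        gcongr
        linarith
      have h₁ := tbs_time_le_sq c (binaryLabeling lo S)
      rw [length_binaryLabeling] at h₁
      have h₂ := max_le (key lo ((firstStage c lo S).take (S.length / 2))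
          (by rw [List.length_take, length_firstStage]; omega))
        (key (lo + S.length / 2) ((firstStage c lo S).drop (S.length / 2))
          (by rw [List.length_drop, length_firstStage]; omega))
      rw [gdc_time_of_two_le c lo hS]
      have : (2 : ℝ) ≤ S.length := by exact_mod_cast hS
      nlinarith

/-- Relabelling within the small labels or within the large labels commutes with the first
stage, because it leaves the binary labeling unchanged. -/
theorem firstStage_map (c : ThirdsRule) (lo : ℕ) {S : List ℕ} {g : ℕ → ℕ}
    (hg : ∀ v, lo + S.length / 2 ≤ g v ↔ lo + S.length / 2 ≤ v) :
    firstStage c lo (S.map g) = (firstStage c lo S).map g := by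
  have : binaryLabeling lo (S.map g) = binaryLabeling lo S := by
    simp [binaryLabeling, hg]
  rw [firstStage, this, Protocol.apply_map, firstStage]

theorem le_relabel_left_iff {lo k : ℕ} (τ : Equiv.Perm (Fin k)) (v : ℕ) :
    lo + k ≤ relabel lo τ v ↔ lo + k ≤ v := by
  by_cases h : lo ≤ v ∧ v < lo + k
  · have := (relabel_mem_iff lo τ v).mpr h
    omega
  · rw [relabel_of_notMem τ h]

theorem le_relabel_right_iff {a m : ℕ} (τ : Equiv.Perm (Fin m)) (v : ℕ) :
    a ≤ relabel a τ v ↔ a ≤ v := by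
  by_cases h : a ≤ v ∧ v < a + m
  · have := (relabel_mem_iff a τ v).mpr h
    omega
  · rw [relabel_of_notMem τ h]

/-- The first stage puts the small labels to the left and the large labels to the right. -/
theorem map_firstStage_permList (c : ThirdsRule) (lo : ℕ) {n : ℕ} (π : Equiv.Perm (Fin n)) :
    (firstStage c lo (permList lo π)).map (fun v => decide (lo + n / 2 ≤ v)) =
      List.replicate (n / 2) false ++ List.replicate (n - n / 2) true := by
  set d : ℕ → Bool := fun v => decide (lo + n / 2 ≤ v)
  have hb : binaryLabeling lo (permList lo π) = (permList lo π).map d := by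
    simp only [binaryLabeling, length_permList, d]
  have hp : (binaryLabeling lo (permList lo π)).Perm
      (List.replicate (n / 2) false ++ List.replicate (n - n / 2) true) := by
    rw [hb]
    refine ((permList_perm_range' lo π).map d).trans (List.Perm.of_eq ?_)
    rw [show List.range' lo n = List.range' lo (n / 2 + (n - n / 2)) by congr 1; omega,
      ← List.range'_append_1, List.map_append]
    congr 1
    · refine List.eq_replicate_iff.mpr ⟨by simp, fun b hb => ?_⟩
      obtain ⟨v, hv, rfl⟩ := List.mem_map.mp hb
      rw [List.mem_range'_1] at hv
      simp only [d, decide_eq_false_iff_not]; omega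
    · refine List.eq_replicate_iff.mpr ⟨by simp, fun b hb => ?_⟩
      obtain ⟨v, hv, rfl⟩ := List.mem_map.mp hb
      rw [List.mem_range'_1] at hv
      simp only [d, decide_eq_true_eq]; omega
  rw [firstStage, ← Protocol.apply_map, ← hb, (tbs_fits_apply c _).2, sortedBits, hp.count_eq,
    hp.count_eq]
  simp [List.count_replicate]

theorem firstStage_permList_perm (c : ThirdsRule) (lo : ℕ) {n : ℕ} (π : Equiv.Perm (Fin n)) :
    (firstStage c lo (permList lo π)).Perm (List.range' lo n) :=
  (Protocol.perm_apply _ _).trans (permList_perm_range' lo π)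

theorem take_firstStage_perm (c : ThirdsRule) (lo : ℕ) {n : ℕ} (π : Equiv.Perm (Fin n)) :
    ((firstStage c lo (permList lo π)).take (n / 2)).Perm (List.range' lo (n / 2)) := by
  obtain ⟨h₁, h₂, h₃⟩ := perm_range'_iff.mp (firstStage_permList_perm c lo π)
  refine perm_range'_iff.mpr ⟨by rw [List.length_take]; omega,
    h₂.sublist (List.take_sublist _ _), fun v hv => ⟨(h₃ v (List.mem_of_mem_take hv)).1, ?_⟩⟩
  have h := congrArg (List.take (n / 2)) (map_firstStage_permList c lo π)
  rw [← List.map_take, List.take_left' List.length_replicate] at h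
  have := (List.eq_replicate_iff.mp h).2 _ (List.mem_map_of_mem hv)
  simpa using this

theorem drop_firstStage_perm (c : ThirdsRule) (lo : ℕ) {n : ℕ} (π : Equiv.Perm (Fin n)) :
    ((firstStage c lo (permList lo π)).drop (n / 2)).Perm
      (List.range' (lo + n / 2) (n - n / 2)) := by
  obtain ⟨h₁, h₂, h₃⟩ := perm_range'_iff.mp (firstStage_permList_perm c lo π)
  refine perm_range'_iff.mpr ⟨by rw [List.length_drop]; omega,
    h₂.sublist (List.drop_sublist _ _), fun v hv => ⟨?_, ?_⟩⟩
  · have h := congrArg (List.drop (n / 2)) (map_firstStage_permList c lo π)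
    rw [← List.map_drop, List.drop_left' List.length_replicate] at h
    have := (List.eq_replicate_iff.mp h).2 _ (List.mem_map_of_mem hv)
    simpa using this
  · have := (h₃ v (List.mem_of_mem_drop hv)).2
    omega

/-- After the first stage, the left half is a uniformly random permutation of the small labels. -/
theorem factorial_mul_sum_take_firstStage (c : ThirdsRule) (lo n : ℕ) (F : List ℕ → ℝ) :
    ((n / 2)! : ℝ) * ∑ π : Equiv.Perm (Fin n),
        F ((firstStage c lo (permList lo π)).take (n / 2)) =
      (n ! : ℝ) * ∑ τ : Equiv.Perm (Fin (n / 2)), F (permList lo τ) := by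
  refine factorial_mul_sum_eq_of_equivariant
    (fun π => (firstStage c lo (permList lo π)).take (n / 2))
    (take_firstStage_perm c lo) (fun τ => ?_) F
  obtain ⟨τ', hτ'⟩ := exists_permList_mul_eq_map_relabel (lo := lo) (n := n) le_rfl
    (by omega) τ
  refine ⟨τ', fun π => ?_⟩
  rw [hτ', firstStage_map c lo (by rw [length_permList]; exact le_relabel_left_iff τ),
    List.map_take]

/-- After the first stage, the right half is a uniformly random permutation of the large
labels. -/
theorem factorial_mul_sum_drop_firstStage (c : ThirdsRule) (lo n : ℕ) (F : List ℕ → ℝ) :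
    ((n - n / 2)! : ℝ) * ∑ π : Equiv.Perm (Fin n),
        F ((firstStage c lo (permList lo π)).drop (n / 2)) =
      (n ! : ℝ) * ∑ τ : Equiv.Perm (Fin (n - n / 2)), F (permList (lo + n / 2) τ) := by
  refine factorial_mul_sum_eq_of_equivariant
    (fun π => (firstStage c lo (permList lo π)).drop (n / 2))
    (drop_firstStage_perm c lo) (fun τ => ?_) F
  obtain ⟨τ', hτ'⟩ := exists_permList_mul_eq_map_relabel (lo := lo) (n := n) (a := lo + n / 2)
    (by omega) (by omega) τ
  refine ⟨τ', fun π => ?_⟩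
  rw [hτ', firstStage_map c lo (by rw [length_permList]; exact le_relabel_right_iff τ),
    List.map_drop]

/-! ### The mean squared deviation of GDC(TBS) -/

/-- The squared deviation of the time of GDC(TBS) from `2 n / 3` is bounded by those of the two
halves and that of the first stage from `n / 3`. -/
theorem gdc_time_sub_sq_le (c : ThirdsRule) (lo : ℕ) {n : ℕ} (hn : 2 ≤ n) {S : List ℕ}
    (hS : S.length = n) :
    ((gdc (tbs c) lo S).time - 2 * (n : ℝ) / 3) ^ 2 ≤
      7 / 6 * (((gdc (tbs c) lo ((firstStage c lo S).take (n / 2))).time -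
          2 * ((n / 2 : ℕ) : ℝ) / 3) ^ 2 +
        ((gdc (tbs c) (lo + n / 2) ((firstStage c lo S).drop (n / 2))).time -
          2 * ((n - n / 2 : ℕ) : ℝ) / 3) ^ 2) +
      14 * (((tbs c (binaryLabeling lo S)).time - (n : ℝ) / 3) ^ 2 + 1) := by
  have h := gdc_time_of_two_le c lo (S := S) (by omega)
  rw [hS] at h
  rw [h]
  generalize (gdc (tbs c) lo ((firstStage c lo S).take (n / 2))).time = t₁
  generalize (gdc (tbs c) (lo + n / 2) ((firstStage c lo S).drop (n / 2))).time = t₂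
  generalize (tbs c (binaryLabeling lo S)).time = g
  have e₁ : (n : ℝ) ≤ 2 * (n - n / 2 : ℕ) := by norm_cast; omega
  have e₂ : (2 : ℝ) * (n - n / 2 : ℕ) ≤ n + 1 := by norm_cast; omega
  have e₃ : (2 : ℝ) * (n / 2 : ℕ) ≤ n := by norm_cast; omega
  set μ : ℝ := max (2 * ((n / 2 : ℕ) : ℝ) / 3) (2 * ((n - n / 2 : ℕ) : ℝ) / 3) with hμ
  have hμ' : μ = 2 * ((n - n / 2 : ℕ) : ℝ) / 3 := max_eq_right (by linarith)
  have hτ := sq_max_sub_le t₁ t₂ (2 * ((n / 2 : ℕ) : ℝ) / 3) (2 * ((n - n / 2 : ℕ) : ℝ) / 3)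
  rw [← hμ] at hτ
  have hδ : (μ - n / 3) ^ 2 ≤ 1 := by
    rw [hμ']
    exact (sq_le_one_iff_abs_le_one _).mpr (abs_le.mpr ⟨by linarith, by linarith⟩)
  have hw := add_sq_le_weighted (max t₁ t₂ - μ) ((g - n / 3) + (μ - n / 3))
  rw [show max t₁ t₂ - μ + ((g - (n : ℝ) / 3) + (μ - n / 3)) =
    g + max t₁ t₂ - 2 * (n : ℝ) / 3 by ring] at hw
  linarith [add_sq_le (a := g - (n : ℝ) / 3) (b := μ - n / 3)]

/-- On a uniformly random permutation of length `n`, the routing time of GDC(TBS) deviates from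
`2 n / 3` by `O(n ^ (3 / 4))` in root mean square. -/
theorem sum_gdc_time_sub_sq_le (c : ThirdsRule) (lo n : ℕ) :
    ∑ π : Equiv.Perm (Fin n), ((gdc (tbs c) lo (permList lo π)).time - 2 * (n : ℝ) / 3) ^ 2 ≤
      60000 * (n * √n) * n ! := by
  induction n using Nat.strong_induction_on generalizing lo with
  | _ n ih =>
  rcases Nat.lt_or_ge n 8 with hn | hn
  · have key (π : Equiv.Perm (Fin n)) :
        ((gdc (tbs c) lo (permList lo π)).time - 2 * (n : ℝ) / 3) ^ 2 ≤ 60000 * (n * √n) := by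
      have h₁ := gdc_time_le_cube c lo (permList lo π)
      have h₂ := (gdc (tbs c) lo (permList lo π)).time_nonneg
      rw [length_permList] at h₁
      have h₀ : (0 : ℝ) ≤ n := by positivity
      have h₃ : (n : ℝ) ≤ (n : ℝ) ^ 3 := by exact_mod_cast Nat.le_self_pow (by norm_num) n
      have h₄ : ((gdc (tbs c) lo (permList lo π)).time - 2 * (n : ℝ) / 3) ^ 2 ≤
          ((n : ℝ) ^ 3) ^ 2 := sq_le_sq' (by linarith) (by linarith)
      have h₅ : ((n : ℝ) ^ 3) ^ 2 ≤ 60000 * n := by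
        have : (n ^ 3) ^ 2 ≤ 60000 * n := by interval_cases n <;> norm_num
        exact_mod_cast this
      linarith [self_le_mul_sqrt_natCast n]
    calc _ ≤ ∑ _π : Equiv.Perm (Fin n), 60000 * ((n : ℝ) * √n) :=
          Finset.sum_le_sum fun π _ => key π
      _ = _ := by
          rw [Finset.sum_const, nsmul_eq_mul, Finset.card_univ, Fintype.card_perm,
            Fintype.card_fin]
          ring
  · -- Dividing by the factorials turns the uniformity of the halves into the induction hypotheses.
    have hL : ∑ π : Equiv.Perm (Fin n), ((gdc (tbs c) lo
        ((firstStage c lo (permList lo π)).take (n / 2))).time -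
          2 * ((n / 2 : ℕ) : ℝ) / 3) ^ 2 ≤
        60000 * (((n / 2 : ℕ) : ℝ) * √((n / 2 : ℕ) : ℝ)) * n ! := by
      have h := factorial_mul_sum_take_firstStage c lo n
        fun S => ((gdc (tbs c) lo S).time - 2 * ((n / 2 : ℕ) : ℝ) / 3) ^ 2
      have h' := mul_le_mul_of_nonneg_left (ih (n / 2) (by omega) lo)
        (show 0 ≤ (n ! : ℝ) by positivity)
      refine le_of_mul_le_mul_left (a := ((n / 2)! : ℝ)) ?_ (by positivity)
      rw [h]
      linarith
    have hR : ∑ π : Equiv.Perm (Fin n), ((gdc (tbs c) (lo + n / 2)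
        ((firstStage c lo (permList lo π)).drop (n / 2))).time -
          2 * ((n - n / 2 : ℕ) : ℝ) / 3) ^ 2 ≤
        60000 * (((n - n / 2 : ℕ) : ℝ) * √((n - n / 2 : ℕ) : ℝ)) * n ! := by
      have h := factorial_mul_sum_drop_firstStage c lo n
        fun S => ((gdc (tbs c) (lo + n / 2) S).time - 2 * ((n - n / 2 : ℕ) : ℝ) / 3) ^ 2
      have h' := mul_le_mul_of_nonneg_left (ih (n - n / 2) (by omega) (lo + n / 2))
        (show 0 ≤ (n ! : ℝ) by positivity)
      refine le_of_mul_le_mul_left (a := ((n - n / 2)! : ℝ)) ?_ (by positivity)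
      rw [h]
      linarith
    have hT := sum_tbs_time_sub_sq_le c (balancedFamily_binaryLabeling lo n)
    rw [Fintype.card_perm, Fintype.card_fin] at hT
    have hsum := Finset.sum_le_sum fun π (_ : π ∈ Finset.univ) =>
      gdc_time_sub_sq_le c lo (n := n) (by omega) (length_permList lo π)
    simp only [Finset.sum_add_distrib, ← Finset.mul_sum, Finset.sum_const, nsmul_eq_mul,
      Finset.card_univ, mul_one, Fintype.card_perm, Fintype.card_fin] at hsum
    have hN : 0 ≤ (n ! : ℝ) := by positivity
    generalize (n ! : ℝ) = N at *
    obtain ⟨e₁, e₂, e₃⟩ : ((n / 2 : ℕ) : ℝ) + (n - n / 2 : ℕ) = n ∧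
        (16 : ℝ) * (n / 2 : ℕ) ≤ 9 * n ∧ (16 : ℝ) * (n - n / 2 : ℕ) ≤ 9 * n := by
      norm_cast; omega
    have k₀ : (0 : ℝ) ≤ (n / 2 : ℕ) := by positivity
    have k₁ : (0 : ℝ) ≤ (n - n / 2 : ℕ) := by positivity
    generalize ((n / 2 : ℕ) : ℝ) = k at *
    generalize ((n - n / 2 : ℕ) : ℝ) = k' at *
    have q₁ := mul_sqrt_le_of_le (x := k) (y := n) k₀ (by linarith)
    have q₂ := mul_sqrt_le_of_le (x := k') (y := n) k₁ (by linarith)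
    have q : k * √k + k' * √k' ≤ 3 / 4 * (n * √n) := by
      have : 3 / 4 * √n * k + 3 / 4 * √n * k' = 3 / 4 * ((n : ℝ) * √n) := by rw [← e₁]; ring
      linarith
    have r : (1 : ℝ) ≤ n * √n := by
      have : (8 : ℝ) ≤ n := by exact_mod_cast hn
      linarith [self_le_mul_sqrt_natCast n]
    have q' := mul_le_mul_of_nonneg_right q hN
    have r' := mul_le_mul_of_nonneg_right r hN
    linarith

theorem averageTime_sub_sq_le (c : ThirdsRule) (n : ℕ) :
    (averageTime c n - 2 * (n : ℝ) / 3) ^ 2 ≤ 60000 * (n * √n) := by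
  have hN : 0 < (n ! : ℝ) := by positivity
  have hcs := sq_sum_le_card_mul_sum_sq (s := Finset.univ)
    (f := fun π : Equiv.Perm (Fin n) => (gdcTBS c π).time - 2 * (n : ℝ) / 3)
  have hV := sum_gdc_time_sub_sq_le c 0 n
  have hg (π : Equiv.Perm (Fin n)) : gdc (tbs c) 0 (permList 0 π) = gdcTBS c π := by
    simp only [gdcTBS, permList, Nat.zero_add]
  simp only [hg] at hV
  have hE : ∑ π : Equiv.Perm (Fin n), ((gdcTBS c π).time - 2 * (n : ℝ) / 3) =
      n ! * (averageTime c n - 2 * (n : ℝ) / 3) := by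
    rw [averageTime, Finset.sum_sub_distrib, Finset.sum_const, nsmul_eq_mul, Finset.card_univ,
      Fintype.card_perm, Fintype.card_fin, mul_sub, mul_div_cancel₀ _ hN.ne']
  rw [hE, Finset.card_univ, Fintype.card_perm, Fintype.card_fin] at hcs
  have h := hcs.trans (mul_le_mul_of_nonneg_left hV hN.le)
  refine le_of_mul_le_mul_left (a := (n ! : ℝ) ^ 2) ?_ (by positivity)
  linarith

end PathRouting

theorem mainTheorem3 :
    ∃ α : ℝ, 1 / 2 < α ∧ α < 1 ∧ ∀ c : PathRouting.ThirdsRule,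
      (fun n : ℕ => PathRouting.averageTime c n - 2 * (n : ℝ) / 3) =O[atTop]
        (fun n : ℕ => (n : ℝ) ^ α) := by
  refine ⟨3 / 4, by norm_num, by norm_num, fun c => ?_⟩
  refine IsBigO.of_bound (√60000) (Eventually.of_forall fun n => ?_)
  have h₀ : (0 : ℝ) ≤ n := Nat.cast_nonneg n
  have hp : ((n : ℝ) ^ (3 / 4 : ℝ)) ^ 2 = n * √n := by
    rw [← Real.rpow_natCast, ← Real.rpow_mul h₀, Real.sqrt_eq_rpow,
      show (3 / 4 : ℝ) * (2 : ℕ) = 1 + 1 / 2 by norm_num,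
      Real.rpow_add_of_nonneg h₀ (by norm_num) (by norm_num), Real.rpow_one]
  rw [Real.norm_eq_abs, Real.norm_of_nonneg (Real.rpow_nonneg h₀ _)]
  refine abs_le_of_sq_le_sq ?_ (by positivity)
  rw [mul_pow, Real.sq_sqrt (by norm_num), hp]
  exact PathRouting.averageTime_sub_sq_le c n
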